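/- Let $\lambda_1\ge\lambda_2>0$. Let $\widetilde{E(2)}$ be the Lie group $\mathbb{R}^3$ with the multiplication $$(x_1,y_1,z_1)*(x_2,y_2,z_2)=(x_1+x_2\cos z_1-y_2\sin z_1,\ y_1+x_2\sin z_1+y_2\cos z_1,\ z_1+z_2)$$ and the left-invariant Riemannian metric $$g(\lambda_1,\lambda_2)=\lambda_1^2(\cos z\,dx+\sin z\,dy)^2+\lambda_2^2(-\sin z\,dx+\cos z\,dy)^2+\frac{1}{\lambda_1^2\lambda_2^2}dz^2,$$ and with the left-invariant orthonormal frame, taken as positively oriented, $$E_1=\tfrac1{\lambda_1}(\cos z\,\partial_x+\sin z\,\partial_y),\quad E_2=\tfrac1{\lambda_2}(-\sin z\,\partial_x+\cos z\,\partial_y),\quad E_3=\lambda_1\lambda_2\,\partial_z .$$ For an immersion $X:\mathbb{C}\to\widetilde{E(2)}$, with coordinate $u+iv$ on $\mathbb{C}$, let $N=\frac{X_u\times X_v}{|X_u\times X_v|}$ be the unit normal, let $N_i=\langle N,E_i\rangle$, and call $\frac{N_1+iN_2}{1+N_3}\in\mathbb{C}\cup\{\infty\}$ (with value $\infty$ where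 $N_3=-1$) the Gauss map of $X$. Let $K$ be a real number with $0<|K|<1$. Then there is a unique function $b:\mathbb{R}\to\mathbb{R}$ with $$b'(v)=\sqrt{\lambda_1^2-K\left(\lambda_1^2\cos^2 b(v)+\lambda_2^2\sin^2 b(v)\right)},\qquad b(0)=0,$$ and a unique function $x_3:\mathbb{R}\to\mathbb{R}$ with $$x_3'(v)=\frac{\lambda_1\lambda_2K}{\lambda_1+b'(v)},\qquad x_3(0)=0,$$ and the mapping $$X(u+iv)=\begin{pmatrix}\frac{1}{\lambda_1^2\lambda_2}\left(\frac1{\lambda_1}\cos x_3(v)\sin b(v)+\frac1{\lambda_2}\sin x_3(v)\cos b(v)\right)x_3'(v)\sinh(-\lambda_1u)\\[2pt] \frac{1}{\lambda_1^2\lambda_2}\left(\frac1{\lambda_1}\sin x_3(v)\sin b(v)-\frac1{\lambda_2}\cos x_3(v)\cos b(v)\right)x_3'(v)\sinh(-\lambda_1u)\\[2pt] x_3(v)\end{pmatrix}$$ is a smooth conformal minimal immersion (that is, one of mean curvature zero) from $\mathbb{C}$ to $\widetilde{E(2)}$ with the metric $g(\lambda_1,\lambda_2)$, whose Gauss map is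 $$u+iv\longmapsto e^{-\lambda_1u}e^{ib(v)}.$$ -/

import Mathlib

open scoped ContDiff

noncomputable section

/-- The universal covering group of the rigid motions of the plane: the space `ℝ³`, with
coordinates `(x, y, z) = (p 0, p 1, p 2)`. Its tangent spaces are identified with `ℝ³` through
the coordinate frame `∂x, ∂y, ∂z`. -/
def E2Tilde : Type := Fin 3 → ℝ

namespace E2Tilde

instance : NormedAddCommGroup E2Tilde := inferInstanceAs (NormedAddCommGroup (Fin 3 → ℝ))

instance : NormedSpace ℝ E2Tilde := inferInstanceAs (NormedSpace ℝ (Fin 3 → ℝ))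

/-- The point (or the tangent vector) with coordinates `(x, y, z)`. -/
def mk (x y z : ℝ) : E2Tilde := ![x, y, z]

instance : Mul E2Tilde :=
  ⟨fun p q => mk (p 0 + q 0 * Real.cos (p 2) - q 1 * Real.sin (p 2))
    (p 1 + q 0 * Real.sin (p 2) + q 1 * Real.cos (p 2)) (p 2 + q 2)⟩

instance : One E2Tilde := ⟨mk 0 0 0⟩

instance : Inv E2Tilde :=
  ⟨fun p => mk (-(p 0) * Real.cos (p 2) - p 1 * Real.sin (p 2))
    (p 0 * Real.sin (p 2) - p 1 * Real.cos (p 2)) (-(p 2))⟩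

instance : Group E2Tilde :=
  Group.ofLeftAxioms
    (by
      intro p q r
      funext i
      fin_cases i
      · change (p 0 + q 0 * Real.cos (p 2) - q 1 * Real.sin (p 2))
            + r 0 * Real.cos (p 2 + q 2) - r 1 * Real.sin (p 2 + q 2)
          = p 0 + (q 0 + r 0 * Real.cos (q 2) - r 1 * Real.sin (q 2)) * Real.cos (p 2)
            - (q 1 + r 0 * Real.sin (q 2) + r 1 * Real.cos (q 2)) * Real.sin (p 2)
        rw [Real.cos_add, Real.sin_add]; ring
      · change (p 1 + q 0 * Real.sin (p 2) + q 1 * Real.cos (p 2))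
            + r 0 * Real.sin (p 2 + q 2) + r 1 * Real.cos (p 2 + q 2)
          = p 1 + (q 0 + r 0 * Real.cos (q 2) - r 1 * Real.sin (q 2)) * Real.sin (p 2)
            + (q 1 + r 0 * Real.sin (q 2) + r 1 * Real.cos (q 2)) * Real.cos (p 2)
        rw [Real.cos_add, Real.sin_add]; ring
      · change p 2 + q 2 + r 2 = p 2 + (q 2 + r 2)
        ring)
    (by
      intro p
      funext i
      fin_cases i
      · change 0 + p 0 * Real.cos 0 - p 1 * Real.sin 0 = p 0
        simp
      · change 0 + p 0 * Real.sin 0 + p 1 * Real.cos 0 = p 1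
        simp
      · change 0 + p 2 = p 2
        simp)
    (by
      intro p
      funext i
      fin_cases i
      · change (-(p 0) * Real.cos (p 2) - p 1 * Real.sin (p 2))
            + p 0 * Real.cos (-(p 2)) - p 1 * Real.sin (-(p 2)) = 0
        rw [Real.cos_neg, Real.sin_neg]; ring
      · change (p 0 * Real.sin (p 2) - p 1 * Real.cos (p 2))
            + p 0 * Real.sin (-(p 2)) + p 1 * Real.cos (-(p 2)) = 0
        rw [Real.cos_neg, Real.sin_neg]; ring
      · change -(p 2) + p 2 = 0
        ring)

instance : LieGroup (modelWithCornersSelf ℝ E2Tilde) ∞ E2Tilde where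
  contMDiff_mul := by
    rw [← modelWithCornersSelf_prod, chartedSpaceSelf_prod, contMDiff_iff_contDiff]
    have h : ∀ i : Fin 3, ContDiff ℝ ∞ (fun p : E2Tilde => p i) := fun i =>
      contDiff_apply (n := ∞) ℝ ℝ i
    have h1 : ∀ i : Fin 3, ContDiff ℝ ∞ (fun p : E2Tilde × E2Tilde => p.1 i) := fun i =>
      (h i).comp contDiff_fst
    have h2 : ∀ i : Fin 3, ContDiff ℝ ∞ (fun p : E2Tilde × E2Tilde => p.2 i) := fun i =>
      (h i).comp contDiff_snd
    refine contDiff_pi (𝕜 := ℝ) (E := E2Tilde × E2Tilde) (F' := fun _ : Fin 3 => ℝ) |>.2 ?_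
    intro i
    fin_cases i
    · exact ((h1 0).add ((h2 0).mul (h1 2).cos)).sub ((h2 1).mul (h1 2).sin)
    · exact ((h1 1).add ((h2 0).mul (h1 2).sin)).add ((h2 1).mul (h1 2).cos)
    · exact (h1 2).add (h2 2)
  contMDiff_inv := by
    rw [contMDiff_iff_contDiff]
    have h : ∀ i : Fin 3, ContDiff ℝ ∞ (fun p : E2Tilde => p i) := fun i =>
      contDiff_apply (n := ∞) ℝ ℝ i
    refine contDiff_pi (𝕜 := ℝ) (E := E2Tilde) (F' := fun _ : Fin 3 => ℝ) |>.2 ?_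
    intro i
    fin_cases i
    · exact ((h 0).neg.mul (h 2).cos).sub ((h 1).mul (h 2).sin)
    · exact ((h 0).mul (h 2).sin).sub ((h 1).mul (h 2).cos)
    · exact (h 2).neg

/-- The left-invariant frame `E₁, E₂, E₃` at the point `p`, for the parameters `l₁, l₂` and
`l₃ = 1 / (l₁ l₂)`. It is declared to be positively oriented. -/
def frame (l₁ l₂ : ℝ) (p : E2Tilde) : Fin 3 → E2Tilde :=
  ![(1 / l₁) • mk (Real.cos (p 2)) (Real.sin (p 2)) 0,
    (1 / l₂) • mk (-Real.sin (p 2)) (Real.cos (p 2)) 0,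
    (l₁ * l₂) • mk 0 0 1]

/-- The left-invariant Riemannian metric
`l₁² (cos z dx + sin z dy)² + l₂² (-sin z dx + cos z dy)² + (l₁ l₂)⁻² dz²`
at the point `p`, evaluated on the tangent vectors `v` and `w`. -/
def metric (l₁ l₂ : ℝ) (p v w : E2Tilde) : ℝ :=
  l₁ ^ 2 * ((Real.cos (p 2) * v 0 + Real.sin (p 2) * v 1)
      * (Real.cos (p 2) * w 0 + Real.sin (p 2) * w 1))
    + l₂ ^ 2 * ((-Real.sin (p 2) * v 0 + Real.cos (p 2) * v 1)
      * (-Real.sin (p 2) * w 0 + Real.cos (p 2) * w 1))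
    + 1 / (l₁ ^ 2 * l₂ ^ 2) * (v 2 * w 2)

/-- The derivative at `p`, in the direction `a`, of the function `q ↦ metric q v w`, the vectors
`v` and `w` being constant in the coordinates. -/
def metricDeriv (l₁ l₂ : ℝ) (p a v w : E2Tilde) : ℝ :=
  fderiv ℝ (fun q => metric l₁ l₂ q v w) p a

/-- The Christoffel symbols of the first kind of the metric,
`[ij, k] = (∂ᵢ g_jk + ∂ⱼ g_ik - ∂ₖ g_ij) / 2`, contracted with `v, w, c`. -/
def christoffelLower (l₁ l₂ : ℝ) (p v w c : E2Tilde) : ℝ :=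
  (metricDeriv l₁ l₂ p v w c + metricDeriv l₁ l₂ p w v c - metricDeriv l₁ l₂ p c v w) / 2

/-- The Christoffel symbols (of the second kind) contracted with `v, w`: the vector `Γ(v, w)` with
`⟨Γ(v, w), c⟩ = christoffelLower v w c` for all `c`. The index is raised with the help of the
orthonormal frame. -/
def christoffel (l₁ l₂ : ℝ) (p v w : E2Tilde) : E2Tilde :=
  ∑ k, christoffelLower l₁ l₂ p v w (frame l₁ l₂ p k) • frame l₁ l₂ p k

/-- The partial derivative of `W : ℂ → ℝ³` in the direction `a ∈ ℂ = ℝ²`: the choice `a = 1` gives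
`∂/∂u`, the choice `a = i` gives `∂/∂v`. -/
def partialD (a : ℂ) (W : ℂ → E2Tilde) (z : ℂ) : E2Tilde := fderiv ℝ W z a

/-- The Levi-Civita covariant derivative, in the direction `a` of the parameter plane, of the
vector field `W` along the map `X`. -/
def covDeriv (l₁ l₂ : ℝ) (X : ℂ → E2Tilde) (a : ℂ) (W : ℂ → E2Tilde) (z : ℂ) : E2Tilde :=
  partialD a W z + christoffel l₁ l₂ (X z) (partialD a X z) (W z)

/-- The coordinates `⟨v, Eᵢ⟩` of the tangent vector `v` at `p` in the orthonormal frame. -/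
def frameCoord (l₁ l₂ : ℝ) (p v : E2Tilde) : Fin 3 → ℝ :=
  fun i => metric l₁ l₂ p v (frame l₁ l₂ p i)

/-- The cross product of two tangent vectors at `p`, for the metric and the orientation given by
the frame. -/
def cross (l₁ l₂ : ℝ) (p v w : E2Tilde) : E2Tilde :=
  ∑ i, (crossProduct (frameCoord l₁ l₂ p v) (frameCoord l₁ l₂ p w)) i • frame l₁ l₂ p i

/-- The unit normal field `N = (X_u × X_v) / |X_u × X_v|` of an immersion `X`. -/
def unitNormal (l₁ l₂ : ℝ) (X : ℂ → E2Tilde) (z : ℂ) : E2Tilde :=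
  let n := cross l₁ l₂ (X z) (partialD 1 X z) (partialD Complex.I X z)
  (1 / Real.sqrt (metric l₁ l₂ (X z) n n)) • n

/-- The first fundamental form. -/
def firstForm (l₁ l₂ : ℝ) (X : ℂ → E2Tilde) (a b : ℂ) (z : ℂ) : ℝ :=
  metric l₁ l₂ (X z) (partialD a X z) (partialD b X z)

/-- The second fundamental form `⟨∇_a X_b, N⟩`. -/
def secondForm (l₁ l₂ : ℝ) (X : ℂ → E2Tilde) (a b : ℂ) (z : ℂ) : ℝ :=
  metric l₁ l₂ (X z) (covDeriv l₁ l₂ X a (partialD b X) z) (unitNormal l₁ l₂ X z)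

/-- The mean curvature: half of the trace of the second fundamental form with respect to the first
one. -/
def meanCurvature (l₁ l₂ : ℝ) (X : ℂ → E2Tilde) (z : ℂ) : ℝ :=
  (secondForm l₁ l₂ X 1 1 z * firstForm l₁ l₂ X Complex.I Complex.I z
      - 2 * secondForm l₁ l₂ X 1 Complex.I z * firstForm l₁ l₂ X 1 Complex.I z
      + secondForm l₁ l₂ X Complex.I Complex.I z * firstForm l₁ l₂ X 1 1 z)
    / (2 * (firstForm l₁ l₂ X 1 1 z * firstForm l₁ l₂ X Complex.I Complex.I z
      - firstForm l₁ l₂ X 1 Complex.I z ^ 2))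

/-- `X` is a smooth immersion. -/
def IsImmersion (X : ℂ → E2Tilde) : Prop :=
  ContDiff ℝ ∞ X ∧ ∀ z, Function.Injective (fderiv ℝ X z)

/-- The pull-back of the metric by `X` is a positive multiple `ρ |dz|²` of the flat metric. -/
def IsConformal (l₁ l₂ : ℝ) (X : ℂ → E2Tilde) : Prop :=
  ∃ ρ : ℂ → ℝ, (∀ z, 0 < ρ z) ∧
    ∀ z a b, metric l₁ l₂ (X z) (fderiv ℝ X z a) (fderiv ℝ X z b) = ρ z * inner ℝ a b

/-- The mean curvature of `X` vanishes identically. -/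
def IsMinimal (l₁ l₂ : ℝ) (X : ℂ → E2Tilde) : Prop :=
  ∀ z, meanCurvature l₁ l₂ X z = 0

/-- The left-invariant Gauss map `(N₁, N₂, N₃)`, with `Nᵢ = ⟨N, Eᵢ⟩`. -/
def leftGaussMap (l₁ l₂ : ℝ) (X : ℂ → E2Tilde) (z : ℂ) : Fin 3 → ℝ :=
  frameCoord l₁ l₂ (X z) (unitNormal l₁ l₂ X z)

/-- The Gauss map with values in the Riemann sphere: the stereographic projection from the south
pole of the left-invariant Gauss map. -/
def gaussMap (l₁ l₂ : ℝ) (X : ℂ → E2Tilde) (z : ℂ) : OnePoint ℂ :=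
  let N := leftGaussMap l₁ l₂ X z
  if N 2 = -1 then OnePoint.infty
  else (((N 0 + Complex.I * N 1) / (1 + N 2) : ℂ) : OnePoint ℂ)

/-- `b' = √(l₁² - K (l₁² cos² b + l₂² sin² b))` on the whole line, and `b(0) = 0`. -/
def IsAngleFunction (l₁ l₂ K : ℝ) (b : ℝ → ℝ) : Prop :=
  (∀ v, HasDerivAt b
    (Real.sqrt (l₁ ^ 2 - K * (l₁ ^ 2 * Real.cos (b v) ^ 2 + l₂ ^ 2 * Real.sin (b v) ^ 2))) v)
  ∧ b 0 = 0

/-- `x₃' = l₁ l₂ K / (l₁ + b')` on the whole line, and `x₃(0) = 0`. -/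
def IsHeightFunction (l₁ l₂ K : ℝ) (b x₃ : ℝ → ℝ) : Prop :=
  (∀ v, HasDerivAt x₃ (l₁ * l₂ * K / (l₁ + deriv b v)) v) ∧ x₃ 0 = 0

/-- The helicoidal map built from `b` and `x₃`. -/
def helicoid (l₁ l₂ : ℝ) (b x₃ : ℝ → ℝ) (w : ℂ) : E2Tilde :=
  let u := w.re
  let v := w.im
  mk (1 / (l₁ ^ 2 * l₂) * (1 / l₁ * Real.cos (x₃ v) * Real.sin (b v)
        + 1 / l₂ * Real.sin (x₃ v) * Real.cos (b v)) * deriv x₃ v * Real.sinh (-l₁ * u))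
    (1 / (l₁ ^ 2 * l₂) * (1 / l₁ * Real.sin (x₃ v) * Real.sin (b v)
        - 1 / l₂ * Real.cos (x₃ v) * Real.cos (b v)) * deriv x₃ v * Real.sinh (-l₁ * u))
    (x₃ v)

end E2Tilde

end

/-!
The proof rests on the function `h = K / (l₁ + b')`, which has no zeros. Since
`(l₁ - b') (l₁ + b') = K (l₁² cos² b + l₂² sin² b)`, the square root and the constant `K` disappear
from the equations: `b' = l₁ - h (l₁² cos² b + l₂² sin² b)`,
`h' = -h² (l₁² - l₂²) sin b cos b` and `x₃' = l₁ l₂ h` (`IsAngleFunction.helicoidSystem`).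

In the left-invariant orthonormal frame the partial derivatives of the helicoid become
`X_u = h cosh(l₁ u) (-sin b, cos b, 0)` and
`X_v = h (-sinh(l₁ u) cos b, -sinh(l₁ u) sin b, 1)` (`HelicoidSystem.fderiv_helicoid_eq_ofFrame`).
They are orthogonal of the same length `|h| cosh(l₁ u)`, so the map is a conformal immersion, and
their normalized cross product is `N = (cos b, sin b, sinh(l₁ u)) / cosh(l₁ u)`, whose
stereographic projection is `exp(-l₁ u) exp(i b)`. By conformality the mean curvature vanishes as
soon as the second fundamental form has opposite values on `X_u` and on `X_v`. Both values are
computed from the second derivatives in the coordinates and the Christoffel symbols in the frame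
(`HelicoidSystem.secondForm_one_one_helicoid`, `HelicoidSystem.secondForm_I_I_helicoid`).

The equation for `b` is autonomous with a smooth, positive and bounded right-hand side. Its solution
is the inverse of a primitive of the reciprocal of the right-hand side; the upper bound makes this
primitive surjective, so the solution lives on the whole line
(`existsUnique_autonomous_solution`).
-/

/-! ### Autonomous equations on the line -/

/-- A primitive on the whole line of a continuous function exists and is unique once its value at
`0` is fixed. -/
theorem existsUnique_primitive {f : ℝ → ℝ} (hf : Continuous f) :
    ∃! g : ℝ → ℝ, (∀ v, HasDerivAt g (f v) v) ∧ g 0 = 0 := by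
  refine ⟨fun v => ∫ t in (0 : ℝ)..v, f t,
    ⟨fun v => hf.integral_hasStrictDerivAt 0 v |>.hasDerivAt, by simp⟩, ?_⟩
  rintro g ⟨hg, hg0⟩
  funext v
  have := intervalIntegral.integral_eq_sub_of_hasDerivAt (a := 0) (b := v) (fun t _ => hg t)
    (hf.intervalIntegrable 0 v)
  simp only [this, hg0, sub_zero]

/-- An autonomous equation `b' = F(b)` with `F` continuous, positive and bounded above has exactly
one solution on the whole line with `b(0) = 0`: it is the inverse function of
`y ↦ ∫₀^y 1/F`. No Lipschitz condition is needed. -/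
theorem existsUnique_autonomous_solution {F : ℝ → ℝ} (hF : Continuous F) {M : ℝ}
    (hpos : ∀ y, 0 < F y) (hM : ∀ y, F y ≤ M) :
    ∃! b : ℝ → ℝ, (∀ v, HasDerivAt b (F (b v)) v) ∧ b 0 = 0 := by
  obtain ⟨G, ⟨hG, hG0⟩, -⟩ := existsUnique_primitive
    (hF.inv₀ fun y => (hpos y).ne')
  have hmono : StrictMono G := strictMono_of_deriv_pos fun y => by
    rw [(hG y).deriv]; exact inv_pos.2 (hpos y)
  have hcont : Continuous G := continuous_iff_continuousAt.2 fun y => (hG y).continuousAt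
  have hMpos : 0 < M := (hpos 0).trans_le (hM 0)
  -- The slope of `G` is at least `1/M`, so `G` is unbounded on both sides.
  have hdiff : ∀ y, HasDerivAt (fun y => G y - y / M) ((F y)⁻¹ - 1 / M) y := fun y =>
    (hG y).sub ((hasDerivAt_id y).div_const M)
  have hslope : Monotone fun y => G y - y / M := by
    refine monotone_of_deriv_nonneg (fun y => (hdiff y).differentiableAt) fun y => ?_
    rw [(hdiff y).deriv, one_div, sub_nonneg]
    exact inv_anti₀ (hpos y) (hM y)
  have hsurj : Function.Surjective G := by
    refine hcont.surjective ?_ ?_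
    · refine Filter.tendsto_atTop_mono' _ ?_ (Filter.tendsto_id.atTop_div_const hMpos)
      filter_upwards [Filter.eventually_ge_atTop 0] with y hy
      have := hslope hy
      simp only [hG0, zero_div, sub_zero] at this
      simpa using this
    · refine Filter.tendsto_atBot_mono' _ ?_ (Filter.tendsto_id.atBot_div_const hMpos)
      filter_upwards [Filter.eventually_le_atBot 0] with y hy
      have := hslope hy
      simp only [hG0, zero_div, sub_zero] at this
      simpa using this
  let e : ℝ ≃o ℝ := hmono.orderIsoOfSurjective G hsurj
  have he : ∀ v, G (e.symm v) = v := fun v => e.apply_symm_apply v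
  refine ⟨e.symm, ⟨fun v => ?_, hmono.injective (by rw [he, hG0])⟩, ?_⟩
  · simpa using HasDerivAt.of_local_left_inverse e.symm.continuous.continuousAt (hG (e.symm v))
      (inv_ne_zero (hpos _).ne') (Filter.Eventually.of_forall he)
  · rintro b ⟨hb, hb0⟩
    have hGb : ∀ v, HasDerivAt (G ∘ b) 1 v := fun v => by
      simpa [(hpos (b v)).ne'] using (hG (b v)).comp v (hb v)
    obtain ⟨g, -, hg⟩ := existsUnique_primitive (continuous_const (y := (1 : ℝ)))
    have h : G ∘ b = id := (hg _ ⟨hGb, by simp [hb0, hG0]⟩).trans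
      (hg _ ⟨fun v => hasDerivAt_id v, rfl⟩).symm
    funext v
    exact hmono.injective ((congrFun h v).trans (he v).symm)

/-- Solutions of an autonomous equation with smooth right-hand side are smooth. -/
theorem contDiff_of_autonomous {F b : ℝ → ℝ} (hF : ContDiff ℝ ∞ F)
    (hb : ∀ v, HasDerivAt b (F (b v)) v) : ContDiff ℝ ∞ b := by
  have hd : deriv b = F ∘ b := funext fun v => (hb v).deriv
  refine contDiff_infty.2 fun n => ?_
  induction n with
  | zero =>
    exact contDiff_zero.2 (continuous_iff_continuousAt.2 fun v => (hb v).continuousAt)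
  | succ n ih =>
    rw [Nat.cast_succ, contDiff_succ_iff_deriv]
    refine ⟨fun v => (hb v).differentiableAt, fun h => absurd h (by simp), ?_⟩
    rw [hd]
    exact (contDiff_infty.1 hF n).comp ih

/-- A primitive of a smooth function is smooth. -/
theorem contDiff_of_hasDerivAt {f g : ℝ → ℝ} (hf : ContDiff ℝ ∞ f)
    (hg : ∀ v, HasDerivAt g (f v) v) : ContDiff ℝ ∞ g := by
  refine contDiff_infty_iff_deriv.2 ⟨fun v => (hg v).differentiableAt, ?_⟩
  rwa [show deriv g = f from funext fun v => (hg v).deriv]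

namespace E2Tilde

/-! ### The angle and height functions -/

theorem angle_radicand_pos {l₁ l₂ K : ℝ} (hl₂ : 0 < l₂) (hl : l₂ ≤ l₁) (hK : |K| < 1) (y : ℝ) :
    0 < l₁ ^ 2 - K * (l₁ ^ 2 * Real.cos y ^ 2 + l₂ ^ 2 * Real.sin y ^ 2) := by
  have h1 : 0 < l₁ ^ 2 := by have := hl₂.trans_le hl; positivity
  have h2 : l₂ ^ 2 ≤ l₁ ^ 2 := by gcongr
  have hle : l₁ ^ 2 * Real.cos y ^ 2 + l₂ ^ 2 * Real.sin y ^ 2 ≤ l₁ ^ 2 := by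
    nlinarith [Real.sin_sq_add_cos_sq y, sq_nonneg (Real.sin y)]
  have hnn : 0 ≤ l₁ ^ 2 * Real.cos y ^ 2 + l₂ ^ 2 * Real.sin y ^ 2 := by positivity
  nlinarith [le_abs_self K, abs_nonneg K, mul_le_mul_of_nonneg_right (le_abs_self K) hnn]

theorem angle_radicand_le {l₁ l₂ K : ℝ} (hl₂ : 0 < l₂) (hl : l₂ ≤ l₁) (hK : |K| < 1) (y : ℝ) :
    l₁ ^ 2 - K * (l₁ ^ 2 * Real.cos y ^ 2 + l₂ ^ 2 * Real.sin y ^ 2) ≤ 2 * l₁ ^ 2 := by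
  -- Replacing `K` by `-K` turns the lower bound into the upper one.
  have := angle_radicand_pos hl₂ hl (K := -K) (by rwa [abs_neg]) y
  linarith

theorem existsUnique_isAngleFunction {l₁ l₂ K : ℝ} (hl₂ : 0 < l₂) (hl : l₂ ≤ l₁)
    (hK : |K| < 1) : ∃! b : ℝ → ℝ, IsAngleFunction l₁ l₂ K b :=
  existsUnique_autonomous_solution
    (F := fun y => √(l₁ ^ 2 - K * (l₁ ^ 2 * Real.cos y ^ 2 + l₂ ^ 2 * Real.sin y ^ 2)))
    (by fun_prop) (fun y => Real.sqrt_pos.2 (angle_radicand_pos hl₂ hl hK y))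
    (fun y => Real.sqrt_le_sqrt (angle_radicand_le hl₂ hl hK y))

theorem IsAngleFunction.contDiff {l₁ l₂ K : ℝ} {b : ℝ → ℝ} (hl₂ : 0 < l₂) (hl : l₂ ≤ l₁)
    (hK : |K| < 1) (hb : IsAngleFunction l₁ l₂ K b) : ContDiff ℝ ∞ b :=
  contDiff_of_autonomous
    (F := fun y => √(l₁ ^ 2 - K * (l₁ ^ 2 * Real.cos y ^ 2 + l₂ ^ 2 * Real.sin y ^ 2)))
    (ContDiff.sqrt (by fun_prop) fun y => (angle_radicand_pos hl₂ hl hK y).ne') hb.1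

/-- The function `h = K / (l₁ + b')`. It is the conformal scale of the helicoid along its axis, and
`b`, `x₃` and `h` solve a first-order system that is polynomial in `h`, `cos b`, `sin b`. -/
noncomputable def scale (l₁ K : ℝ) (b : ℝ → ℝ) (v : ℝ) : ℝ := K / (l₁ + deriv b v)

/-- The system `b' = l₁ - h (l₁² cos² b + l₂² sin² b)`, `h' = -h² (l₁² - l₂²) sin b cos b`,
`x₃' = l₁ l₂ h` with `h` nowhere zero and all functions smooth. -/
structure HelicoidSystem (l₁ l₂ : ℝ) (b x₃ h : ℝ → ℝ) : Prop where
  contDiff_b : ContDiff ℝ ∞ b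
  contDiff_x₃ : ContDiff ℝ ∞ x₃
  contDiff_h : ContDiff ℝ ∞ h
  h_ne : ∀ v, h v ≠ 0
  hasDerivAt_b : ∀ v, HasDerivAt b
    (l₁ - h v * (l₁ ^ 2 * Real.cos (b v) ^ 2 + l₂ ^ 2 * Real.sin (b v) ^ 2)) v
  hasDerivAt_h : ∀ v, HasDerivAt h
    (-(h v) ^ 2 * (l₁ ^ 2 - l₂ ^ 2) * Real.sin (b v) * Real.cos (b v)) v
  hasDerivAt_x₃ : ∀ v, HasDerivAt x₃ (l₁ * l₂ * h v) v

section

variable {l₁ l₂ K : ℝ} {b x₃ : ℝ → ℝ}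

theorem IsAngleFunction.deriv_pos (hl₂ : 0 < l₂) (hl : l₂ ≤ l₁) (hK : |K| < 1)
    (hb : IsAngleFunction l₁ l₂ K b) (v : ℝ) : 0 < deriv b v := by
  rw [(hb.1 v).deriv]
  exact Real.sqrt_pos.2 (angle_radicand_pos hl₂ hl hK _)

theorem IsAngleFunction.contDiff_deriv (hl₂ : 0 < l₂) (hl : l₂ ≤ l₁) (hK : |K| < 1)
    (hb : IsAngleFunction l₁ l₂ K b) : ContDiff ℝ ∞ (deriv b) :=
  (contDiff_infty_iff_deriv.1 (hb.contDiff hl₂ hl hK)).2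

theorem IsAngleFunction.contDiff_scale (hl₂ : 0 < l₂) (hl : l₂ ≤ l₁) (hK : |K| < 1)
    (hb : IsAngleFunction l₁ l₂ K b) : ContDiff ℝ ∞ (scale l₁ K b) :=
  contDiff_const.div (contDiff_const.add (hb.contDiff_deriv hl₂ hl hK)) fun v =>
    (add_pos (hl₂.trans_le hl) (hb.deriv_pos hl₂ hl hK v)).ne'

theorem IsAngleFunction.existsUnique_isHeightFunction (hl₂ : 0 < l₂) (hl : l₂ ≤ l₁)
    (hK : |K| < 1) (hb : IsAngleFunction l₁ l₂ K b) :
    ∃! x₃ : ℝ → ℝ, IsHeightFunction l₁ l₂ K b x₃ := by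
  refine existsUnique_primitive (f := fun v => l₁ * l₂ * K / (l₁ + deriv b v)) ?_
  simp only [mul_div_assoc]
  exact continuous_const.mul (hb.contDiff_scale hl₂ hl hK).continuous

/-- The second-order form of the equation for the angle, free of the square root. -/
theorem IsAngleFunction.hasDerivAt_deriv (hl₂ : 0 < l₂) (hl : l₂ ≤ l₁) (hK : |K| < 1)
    (hb : IsAngleFunction l₁ l₂ K b) (v : ℝ) :
    HasDerivAt (deriv b) (K * (l₁ ^ 2 - l₂ ^ 2) * Real.sin (b v) * Real.cos (b v)) v := by
  have hd : deriv b = fun v => √(l₁ ^ 2 - K * (l₁ ^ 2 * Real.cos (b v) ^ 2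
      + l₂ ^ 2 * Real.sin (b v) ^ 2)) := funext fun v => (hb.1 v).deriv
  have hpos := angle_radicand_pos hl₂ hl hK (b v)
  have hs := (Real.sqrt_pos.2 hpos).ne'
  have hb' := hb.1 v
  have hc := (hb'.cos.pow 2).const_mul (l₁ ^ 2)
  have h := (((hc.add ((hb'.sin.pow 2).const_mul (l₂ ^ 2))).const_mul K).const_sub
    (l₁ ^ 2)).sqrt hpos.ne'
  rw [hd]
  refine h.congr_deriv ?_
  simp only [Pi.add_apply, Pi.pow_apply]
  generalize √(l₁ ^ 2 - K * (l₁ ^ 2 * Real.cos (b v) ^ 2 + l₂ ^ 2 * Real.sin (b v) ^ 2)) = r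
    at hs ⊢
  field_simp
  ring

theorem IsAngleFunction.helicoidSystem (hl₂ : 0 < l₂) (hl : l₂ ≤ l₁) (hK₀ : K ≠ 0)
    (hK : |K| < 1) (hb : IsAngleFunction l₁ l₂ K b) (hx : IsHeightFunction l₁ l₂ K b x₃) :
    HelicoidSystem l₁ l₂ b x₃ (scale l₁ K b) := by
  have hpos : ∀ v, 0 < l₁ + deriv b v := fun v =>
    add_pos (hl₂.trans_le hl) (hb.deriv_pos hl₂ hl hK v)
  have hx' : ∀ v, HasDerivAt x₃ (l₁ * l₂ * scale l₁ K b v) v := fun v => by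
    simpa only [scale, mul_div_assoc] using hx.1 v
  have hh := hb.contDiff_scale hl₂ hl hK
  refine ⟨hb.contDiff hl₂ hl hK, contDiff_of_hasDerivAt (contDiff_const.mul hh) hx', hh,
    fun v => div_ne_zero hK₀ (hpos v).ne', fun v => ?_, fun v => ?_, hx'⟩
  · refine (hb.1 v).differentiableAt.hasDerivAt.congr_deriv ?_
    -- The equation for `b` reads `(l₁ - b') (l₁ + b') = K (l₁² cos² b + l₂² sin² b)`.
    have hsq : deriv b v ^ 2 = l₁ ^ 2
        - K * (l₁ ^ 2 * Real.cos (b v) ^ 2 + l₂ ^ 2 * Real.sin (b v) ^ 2) := by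
      rw [(hb.1 v).deriv]
      exact Real.sq_sqrt (angle_radicand_pos hl₂ hl hK (b v)).le
    have := (hpos v).ne'
    rw [scale]
    field_simp
    linear_combination hsq
  · have := (hpos v).ne'
    refine ((hasDerivAt_const v K).div ((hb.hasDerivAt_deriv hl₂ hl hK v).const_add l₁)
      this).congr_deriv ?_
    rw [scale]
    field_simp
    ring

end

/-! ### The left-invariant frame -/

section Frame

variable {l₁ l₂ : ℝ}

@[simp] theorem mk_zero (x y z : ℝ) : mk x y z 0 = x := rfl

@[simp] theorem mk_one (x y z : ℝ) : mk x y z 1 = y := rfl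

@[simp] theorem mk_two (x y z : ℝ) : mk x y z 2 = z := rfl

/-- The tangent vector at `p` with the coordinates `a` in the left-invariant frame. -/
noncomputable def ofFrame (l₁ l₂ : ℝ) (p : E2Tilde) (a : Fin 3 → ℝ) : E2Tilde :=
  ∑ i, a i • frame l₁ l₂ p i

theorem ofFrame_eq_mk (l₁ l₂ : ℝ) (p : E2Tilde) (a : Fin 3 → ℝ) :
    ofFrame l₁ l₂ p a =
      mk (a 0 / l₁ * Real.cos (p 2) - a 1 / l₂ * Real.sin (p 2))
        (a 0 / l₁ * Real.sin (p 2) + a 1 / l₂ * Real.cos (p 2)) (l₁ * l₂ * a 2) := by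
  rw [ofFrame, Fin.sum_univ_three]
  funext i
  fin_cases i
  · change a 0 * (1 / l₁ * Real.cos (p 2)) + a 1 * (1 / l₂ * -Real.sin (p 2))
      + a 2 * (l₁ * l₂ * 0) = a 0 / l₁ * Real.cos (p 2) - a 1 / l₂ * Real.sin (p 2)
    ring
  · change a 0 * (1 / l₁ * Real.sin (p 2)) + a 1 * (1 / l₂ * Real.cos (p 2))
      + a 2 * (l₁ * l₂ * 0) = a 0 / l₁ * Real.sin (p 2) + a 1 / l₂ * Real.cos (p 2)
    ring
  · change a 0 * (1 / l₁ * 0) + a 1 * (1 / l₂ * 0) + a 2 * (l₁ * l₂ * 1) = l₁ * l₂ * a 2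
    ring

theorem smul_ofFrame (p : E2Tilde) (c : ℝ) (a : Fin 3 → ℝ) :
    c • ofFrame l₁ l₂ p a = ofFrame l₁ l₂ p (c • a) := by
  simp only [ofFrame, Finset.smul_sum, smul_smul, Pi.smul_apply, smul_eq_mul]

/-- The left-invariant form `cos z dx + sin z dy` on a vector given in the frame. -/
theorem cos_mul_ofFrame_add (p : E2Tilde) (a : Fin 3 → ℝ) :
    Real.cos (p 2) * (ofFrame l₁ l₂ p a) 0 + Real.sin (p 2) * (ofFrame l₁ l₂ p a) 1 =
      a 0 / l₁ := by
  simp only [ofFrame_eq_mk, mk_zero, mk_one]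
  linear_combination a 0 / l₁ * Real.sin_sq_add_cos_sq (p 2)

/-- The left-invariant form `-sin z dx + cos z dy` on a vector given in the frame. -/
theorem neg_sin_mul_ofFrame_add (p : E2Tilde) (a : Fin 3 → ℝ) :
    -Real.sin (p 2) * (ofFrame l₁ l₂ p a) 0 + Real.cos (p 2) * (ofFrame l₁ l₂ p a) 1 =
      a 1 / l₂ := by
  simp only [ofFrame_eq_mk, mk_zero, mk_one]
  linear_combination a 1 / l₂ * Real.sin_sq_add_cos_sq (p 2)

theorem ofFrame_two (p : E2Tilde) (a : Fin 3 → ℝ) :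
    (ofFrame l₁ l₂ p a) 2 = l₁ * l₂ * a 2 := by
  rw [ofFrame_eq_mk, mk_two]

theorem metric_ofFrame_right (h₁ : l₁ ≠ 0) (h₂ : l₂ ≠ 0) (p v : E2Tilde) (a : Fin 3 → ℝ) :
    metric l₁ l₂ p v (ofFrame l₁ l₂ p a) =
      l₁ * a 0 * (Real.cos (p 2) * v 0 + Real.sin (p 2) * v 1)
        + l₂ * a 1 * (-Real.sin (p 2) * v 0 + Real.cos (p 2) * v 1)
        + a 2 * v 2 / (l₁ * l₂) := by
  rw [metric, cos_mul_ofFrame_add, neg_sin_mul_ofFrame_add, ofFrame_two]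
  field_simp

/-- The frame is orthonormal. -/
theorem metric_ofFrame_ofFrame (h₁ : l₁ ≠ 0) (h₂ : l₂ ≠ 0) (p : E2Tilde) (a c : Fin 3 → ℝ) :
    metric l₁ l₂ p (ofFrame l₁ l₂ p a) (ofFrame l₁ l₂ p c) =
      a 0 * c 0 + a 1 * c 1 + a 2 * c 2 := by
  rw [metric_ofFrame_right h₁ h₂, cos_mul_ofFrame_add, neg_sin_mul_ofFrame_add, ofFrame_two]
  field_simp

theorem frame_eq_ofFrame (l₁ l₂ : ℝ) (p : E2Tilde) (i : Fin 3) :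
    frame l₁ l₂ p i = ofFrame l₁ l₂ p (Pi.single i 1) := by
  simp [ofFrame, Pi.single_apply]

theorem frameCoord_ofFrame (h₁ : l₁ ≠ 0) (h₂ : l₂ ≠ 0) (p : E2Tilde) (a : Fin 3 → ℝ) :
    frameCoord l₁ l₂ p (ofFrame l₁ l₂ p a) = a := by
  funext i
  rw [frameCoord, frame_eq_ofFrame, metric_ofFrame_ofFrame h₁ h₂]
  fin_cases i <;> simp

theorem cross_ofFrame (h₁ : l₁ ≠ 0) (h₂ : l₂ ≠ 0) (p : E2Tilde) (a c : Fin 3 → ℝ) :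
    cross l₁ l₂ p (ofFrame l₁ l₂ p a) (ofFrame l₁ l₂ p c) =
      ofFrame l₁ l₂ p (crossProduct a c) := by
  simp only [cross, frameCoord_ofFrame h₁ h₂]
  rfl

theorem metric_add_left (p v w c : E2Tilde) :
    metric l₁ l₂ p (v + w) c = metric l₁ l₂ p v c + metric l₁ l₂ p w c := by
  have h : ∀ i, (v + w) i = v i + w i := fun _ => rfl
  simp only [metric, h]
  ring

/-! ### Christoffel symbols in the frame -/

theorem hasFDerivAt_apply (i : Fin 3) (p : E2Tilde) :
    HasFDerivAt (fun q : E2Tilde => q i)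
      (ContinuousLinearMap.proj (R := ℝ) (φ := fun _ : Fin 3 => ℝ) i : E2Tilde →L[ℝ] ℝ) p :=
  (ContinuousLinearMap.proj (R := ℝ) (φ := fun _ : Fin 3 => ℝ) i : E2Tilde →L[ℝ] ℝ).hasFDerivAt

/-- The metric coefficients depend on the third coordinate only. -/
theorem metricDeriv_eq (p a v w : E2Tilde) :
    metricDeriv l₁ l₂ p a v w = (l₁ ^ 2 - l₂ ^ 2) * a 2
      * ((-Real.sin (p 2) * v 0 + Real.cos (p 2) * v 1)
          * (Real.cos (p 2) * w 0 + Real.sin (p 2) * w 1)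
        + (Real.cos (p 2) * v 0 + Real.sin (p 2) * v 1)
          * (-Real.sin (p 2) * w 0 + Real.cos (p 2) * w 1)) := by
  have hc := Real.hasDerivAt_cos (p 2)
  have hs := Real.hasDerivAt_sin (p 2)
  have e1 : ∀ v : E2Tilde, HasDerivAt (fun t => Real.cos t * v 0 + Real.sin t * v 1)
      (-Real.sin (p 2) * v 0 + Real.cos (p 2) * v 1) (p 2) := fun v =>
    (hc.mul_const _).add (hs.mul_const _)
  have e2 : ∀ v : E2Tilde, HasDerivAt (fun t => -Real.sin t * v 0 + Real.cos t * v 1)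
      (-Real.cos (p 2) * v 0 + -Real.sin (p 2) * v 1) (p 2) := fun v =>
    (hs.neg.mul_const _).add (hc.mul_const _)
  have h := ((((e1 v).mul (e1 w)).const_mul (l₁ ^ 2)).add
    (((e2 v).mul (e2 w)).const_mul (l₂ ^ 2))).add_const (1 / (l₁ ^ 2 * l₂ ^ 2) * (v 2 * w 2))
  have h' := h.comp_hasFDerivAt p (hasFDerivAt_apply 2 p)
  refine (DFunLike.congr_fun h'.fderiv a).trans ?_
  change _ * a 2 = _
  ring

theorem metricDeriv_ofFrame (h₁ : l₁ ≠ 0) (h₂ : l₂ ≠ 0) (p : E2Tilde) (a v w : Fin 3 → ℝ) :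
    metricDeriv l₁ l₂ p (ofFrame l₁ l₂ p a) (ofFrame l₁ l₂ p v) (ofFrame l₁ l₂ p w) =
      (l₁ ^ 2 - l₂ ^ 2) * a 2 * (v 0 * w 1 + v 1 * w 0) := by
  simp only [metricDeriv_eq, cos_mul_ofFrame_add, neg_sin_mul_ofFrame_add, ofFrame_two]
  field_simp
  ring

theorem christoffelLower_ofFrame (h₁ : l₁ ≠ 0) (h₂ : l₂ ≠ 0) (p : E2Tilde)
    (v c : Fin 3 → ℝ) :
    christoffelLower l₁ l₂ p (ofFrame l₁ l₂ p v) (ofFrame l₁ l₂ p v) (ofFrame l₁ l₂ p c) =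
      (l₁ ^ 2 - l₂ ^ 2) * (v 2 * v 0 * c 1 + v 2 * v 1 * c 0 - v 0 * v 1 * c 2) := by
  simp only [christoffelLower, metricDeriv_ofFrame h₁ h₂]
  ring

/-- The Christoffel symbols of the first and of the second kind, evaluated on one vector twice;
the third slot is the one that the metric lowers. -/
theorem metric_christoffel (h₁ : l₁ ≠ 0) (h₂ : l₂ ≠ 0) (p : E2Tilde) (v c : Fin 3 → ℝ) :
    metric l₁ l₂ p (christoffel l₁ l₂ p (ofFrame l₁ l₂ p v) (ofFrame l₁ l₂ p v))
      (ofFrame l₁ l₂ p c) =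
      (l₁ ^ 2 - l₂ ^ 2) * (v 2 * v 0 * c 1 + v 2 * v 1 * c 0 - v 0 * v 1 * c 2) := by
  change metric l₁ l₂ p (ofFrame l₁ l₂ p fun k => christoffelLower l₁ l₂ p (ofFrame l₁ l₂ p v)
    (ofFrame l₁ l₂ p v) (frame l₁ l₂ p k)) (ofFrame l₁ l₂ p c) = _
  rw [metric_ofFrame_ofFrame h₁ h₂]
  simp only [frame_eq_ofFrame, christoffelLower_ofFrame h₁ h₂]
  simp
  ring

end Frame

/-! ### Maps that separate the two parameters -/

/-- The map `u + iv ↦ (φ₀(v) ψ(u), φ₁(v) ψ(u), φ₂(v))`. The helicoid and its partial derivatives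
have this form. -/
def sepMap (φ₀ φ₁ φ₂ ψ : ℝ → ℝ) (w : ℂ) : E2Tilde :=
  mk (φ₀ w.im * ψ w.re) (φ₁ w.im * ψ w.re) (φ₂ w.im)

theorem hasFDerivAt_comp_re {f : ℝ → ℝ} {f' : ℝ} {w : ℂ} (hf : HasDerivAt f f' w.re) :
    HasFDerivAt (fun w : ℂ => f w.re) (f' • Complex.reCLM) w :=
  hf.comp_hasFDerivAt w Complex.reCLM.hasFDerivAt

theorem hasFDerivAt_comp_im {f : ℝ → ℝ} {f' : ℝ} {w : ℂ} (hf : HasDerivAt f f' w.im) :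
    HasFDerivAt (fun w : ℂ => f w.im) (f' • Complex.imCLM) w :=
  hf.comp_hasFDerivAt w Complex.imCLM.hasFDerivAt

theorem fderiv_sepMap {φ₀ φ₁ φ₂ ψ : ℝ → ℝ} {d₀ d₁ d₂ e : ℝ} {w : ℂ}
    (h₀ : HasDerivAt φ₀ d₀ w.im) (h₁ : HasDerivAt φ₁ d₁ w.im) (h₂ : HasDerivAt φ₂ d₂ w.im)
    (h : HasDerivAt ψ e w.re) (a : ℂ) :
    fderiv ℝ (sepMap φ₀ φ₁ φ₂ ψ) w a =
      mk (φ₀ w.im * e * a.re + d₀ * ψ w.re * a.im) (φ₁ w.im * e * a.re + d₁ * ψ w.re * a.im)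
        (d₂ * a.im) := by
  have H := hasFDerivAt_comp_re h
  have H₀ := (hasFDerivAt_comp_im h₀).mul H
  have H₁ := (hasFDerivAt_comp_im h₁).mul H
  have H₂ := hasFDerivAt_comp_im h₂
  have hd : DifferentiableAt ℝ (sepMap φ₀ φ₁ φ₂ ψ) w := by
    refine differentiableAt_pi (𝕜 := ℝ) (E := ℂ) (F' := fun _ : Fin 3 => ℝ) |>.2 fun i => ?_
    fin_cases i
    exacts [H₀.differentiableAt, H₁.differentiableAt, H₂.differentiableAt]
  have hi : ∀ i, fderiv ℝ (sepMap φ₀ φ₁ φ₂ ψ) w a i =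
      fderiv ℝ (fun w => sepMap φ₀ φ₁ φ₂ ψ w i) w a := fun i =>
    (DFunLike.congr_fun ((hasFDerivAt_apply i _).comp w hd.hasFDerivAt).fderiv a).symm
  funext i
  rw [hi]
  fin_cases i
  · refine (DFunLike.congr_fun H₀.fderiv a).trans ?_
    change φ₀ w.im * (e * a.re) + ψ w.re * (d₀ * a.im) = φ₀ w.im * e * a.re + d₀ * ψ w.re * a.im
    ring
  · refine (DFunLike.congr_fun H₁.fderiv a).trans ?_
    change φ₁ w.im * (e * a.re) + ψ w.re * (d₁ * a.im) = φ₁ w.im * e * a.re + d₁ * ψ w.re * a.im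
    ring
  · exact DFunLike.congr_fun H₂.fderiv a

theorem contDiff_sepMap {φ₀ φ₁ φ₂ ψ : ℝ → ℝ} (h₀ : ContDiff ℝ ∞ φ₀) (h₁ : ContDiff ℝ ∞ φ₁)
    (h₂ : ContDiff ℝ ∞ φ₂) (h : ContDiff ℝ ∞ ψ) : ContDiff ℝ ∞ (sepMap φ₀ φ₁ φ₂ ψ) := by
  have hre : ContDiff ℝ ∞ Complex.re := Complex.reCLM.contDiff
  have him : ContDiff ℝ ∞ Complex.im := Complex.imCLM.contDiff
  refine contDiff_pi (𝕜 := ℝ) (E := ℂ) (F' := fun _ : Fin 3 => ℝ) |>.2 fun i => ?_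
  fin_cases i
  · exact (h₀.comp him).mul (h.comp hre)
  · exact (h₁.comp him).mul (h.comp hre)
  · exact h₂.comp him

namespace HelicoidSystem

/-! ### First derivatives of the helicoid -/

section

variable {l₁ l₂ : ℝ} {b x₃ h : ℝ → ℝ}

/-- The first coordinate of the helicoid is `coordX * sinh (-l₁ u)`. -/
noncomputable def coordX (l₁ l₂ : ℝ) (b x₃ h : ℝ → ℝ) (v : ℝ) : ℝ :=
  h v / l₁ * (Real.cos (x₃ v) * Real.sin (b v) / l₁ + Real.sin (x₃ v) * Real.cos (b v) / l₂)

/-- The second coordinate of the helicoid is `coordY * sinh (-l₁ u)`. -/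
noncomputable def coordY (l₁ l₂ : ℝ) (b x₃ h : ℝ → ℝ) (v : ℝ) : ℝ :=
  h v / l₁ * (Real.sin (x₃ v) * Real.sin (b v) / l₁ - Real.cos (x₃ v) * Real.cos (b v) / l₂)

/-- The derivative of `coordX`. -/
noncomputable def coordX' (l₁ l₂ : ℝ) (b x₃ h : ℝ → ℝ) (v : ℝ) : ℝ :=
  h v * (Real.cos (x₃ v) * Real.cos (b v) / l₁ - Real.sin (x₃ v) * Real.sin (b v) / l₂)

/-- The derivative of `coordY`. -/
noncomputable def coordY' (l₁ l₂ : ℝ) (b x₃ h : ℝ → ℝ) (v : ℝ) : ℝ :=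
  h v * (Real.sin (x₃ v) * Real.cos (b v) / l₁ + Real.cos (x₃ v) * Real.sin (b v) / l₂)

theorem helicoid_eq_sepMap (h₁ : l₁ ≠ 0) (h₂ : l₂ ≠ 0) (S : HelicoidSystem l₁ l₂ b x₃ h) :
    helicoid l₁ l₂ b x₃ =
      sepMap (coordX l₁ l₂ b x₃ h) (coordY l₁ l₂ b x₃ h) x₃ (fun u => Real.sinh (-l₁ * u)) := by
  funext w
  simp only [helicoid, sepMap, coordX, coordY, (S.hasDerivAt_x₃ _).deriv]
  congr 1 <;> field_simp

theorem hasDerivAt_coordX (h₁ : l₁ ≠ 0) (h₂ : l₂ ≠ 0) (S : HelicoidSystem l₁ l₂ b x₃ h)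
    (v : ℝ) : HasDerivAt (coordX l₁ l₂ b x₃ h) (coordX' l₁ l₂ b x₃ h v) v := by
  have hb := S.hasDerivAt_b v
  have hx := S.hasDerivAt_x₃ v
  have hh := S.hasDerivAt_h v
  refine ((hh.div_const l₁).mul (((hx.cos.mul hb.sin).div_const l₁).add
    ((hx.sin.mul hb.cos).div_const l₂))).congr_deriv ?_
  have e := Real.sin_sq (b v)
  simp only [coordX', Pi.add_apply, Pi.mul_apply]
  field_simp
  ring_nf
  simp only [e, show Real.sin (b v) ^ 3 = Real.sin (b v) * (1 - Real.cos (b v) ^ 2) by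
    rw [← e]; ring]
  ring

theorem hasDerivAt_coordY (h₁ : l₁ ≠ 0) (h₂ : l₂ ≠ 0) (S : HelicoidSystem l₁ l₂ b x₃ h)
    (v : ℝ) : HasDerivAt (coordY l₁ l₂ b x₃ h) (coordY' l₁ l₂ b x₃ h v) v := by
  have hb := S.hasDerivAt_b v
  have hx := S.hasDerivAt_x₃ v
  have hh := S.hasDerivAt_h v
  refine ((hh.div_const l₁).mul (((hx.sin.mul hb.sin).div_const l₁).sub
    ((hx.cos.mul hb.cos).div_const l₂))).congr_deriv ?_
  have e := Real.sin_sq (b v)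
  simp only [coordY', Pi.sub_apply, Pi.mul_apply]
  field_simp
  ring_nf
  simp only [e, show Real.sin (b v) ^ 3 = Real.sin (b v) * (1 - Real.cos (b v) ^ 2) by
    rw [← e]; ring]
  ring

theorem hasDerivAt_sinh_neg_mul (l u : ℝ) :
    HasDerivAt (fun u => Real.sinh (-l * u)) (-l * Real.cosh (-l * u)) u := by
  have h : HasDerivAt (fun u => -l * u) (-l) u := by
    simpa using (hasDerivAt_id u).const_mul (-l)
  simpa [mul_comm] using h.sinh

theorem hasDerivAt_neg_mul_cosh_neg_mul (l u : ℝ) :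
    HasDerivAt (fun u => -l * Real.cosh (-l * u)) (l ^ 2 * Real.sinh (-l * u)) u := by
  have h : HasDerivAt (fun u => -l * u) (-l) u := by
    simpa using (hasDerivAt_id u).const_mul (-l)
  exact (h.cosh.const_mul (-l)).congr_deriv (by ring)

theorem contDiff_helicoid (h₁ : l₁ ≠ 0) (h₂ : l₂ ≠ 0) (S : HelicoidSystem l₁ l₂ b x₃ h) :
    ContDiff ℝ ∞ (helicoid l₁ l₂ b x₃) := by
  rw [S.helicoid_eq_sepMap h₁ h₂]
  have hb := S.contDiff_b
  have hx := S.contDiff_x₃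
  have hh := S.contDiff_h
  refine contDiff_sepMap ?_ ?_ hx (by fun_prop)
  · exact (hh.div_const _).mul (((hx.cos.mul hb.sin).div_const _).add
      ((hx.sin.mul hb.cos).div_const _))
  · exact (hh.div_const _).mul (((hx.sin.mul hb.sin).div_const _).sub
      ((hx.cos.mul hb.cos).div_const _))

theorem fderiv_helicoid (h₁ : l₁ ≠ 0) (h₂ : l₂ ≠ 0) (S : HelicoidSystem l₁ l₂ b x₃ h)
    (w a : ℂ) :
    fderiv ℝ (helicoid l₁ l₂ b x₃) w a =
      E2Tilde.mk (coordX l₁ l₂ b x₃ h w.im * (-l₁ * Real.cosh (-l₁ * w.re)) * a.re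
          + coordX' l₁ l₂ b x₃ h w.im * Real.sinh (-l₁ * w.re) * a.im)
        (coordY l₁ l₂ b x₃ h w.im * (-l₁ * Real.cosh (-l₁ * w.re)) * a.re
          + coordY' l₁ l₂ b x₃ h w.im * Real.sinh (-l₁ * w.re) * a.im)
        (l₁ * l₂ * h w.im * a.im) := by
  rw [S.helicoid_eq_sepMap h₁ h₂]
  exact fderiv_sepMap (S.hasDerivAt_coordX h₁ h₂ _) (S.hasDerivAt_coordY h₁ h₂ _)
    (S.hasDerivAt_x₃ _) (hasDerivAt_sinh_neg_mul _ _) a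

theorem helicoid_two (w : ℂ) : helicoid l₁ l₂ b x₃ w 2 = x₃ w.im := rfl

/-- In the frame, `X_u = h cosh(l₁ u) (-sin b, cos b, 0)` and
`X_v = h (-sinh(l₁ u) cos b, -sinh(l₁ u) sin b, 1)`: two orthogonal vectors of the same length. -/
theorem fderiv_helicoid_eq_ofFrame (h₁ : l₁ ≠ 0) (h₂ : l₂ ≠ 0)
    (S : HelicoidSystem l₁ l₂ b x₃ h) (w a : ℂ) :
    fderiv ℝ (helicoid l₁ l₂ b x₃) w a = ofFrame l₁ l₂ (helicoid l₁ l₂ b x₃ w)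
      (h w.im • ![-Real.cosh (l₁ * w.re) * Real.sin (b w.im) * a.re
          - Real.sinh (l₁ * w.re) * Real.cos (b w.im) * a.im,
        Real.cosh (l₁ * w.re) * Real.cos (b w.im) * a.re
          - Real.sinh (l₁ * w.re) * Real.sin (b w.im) * a.im,
        a.im]) := by
  rw [S.fderiv_helicoid h₁ h₂, ofFrame_eq_mk, helicoid_two]
  simp only [neg_mul, Real.cosh_neg, Real.sinh_neg, coordX, coordY, coordX', coordY',
    Pi.smul_apply, smul_eq_mul, Matrix.cons_val]
  congr 1 <;> field_simp <;> ring

theorem partialD_one_helicoid (h₁ : l₁ ≠ 0) (h₂ : l₂ ≠ 0)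
    (S : HelicoidSystem l₁ l₂ b x₃ h) (w : ℂ) :
    partialD 1 (helicoid l₁ l₂ b x₃) w = ofFrame l₁ l₂ (helicoid l₁ l₂ b x₃ w)
      (h w.im • ![-Real.cosh (l₁ * w.re) * Real.sin (b w.im),
        Real.cosh (l₁ * w.re) * Real.cos (b w.im), 0]) := by
  rw [partialD, S.fderiv_helicoid_eq_ofFrame h₁ h₂]
  simp

theorem partialD_I_helicoid (h₁ : l₁ ≠ 0) (h₂ : l₂ ≠ 0)
    (S : HelicoidSystem l₁ l₂ b x₃ h) (w : ℂ) :
    partialD Complex.I (helicoid l₁ l₂ b x₃) w = ofFrame l₁ l₂ (helicoid l₁ l₂ b x₃ w)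
      (h w.im • ![-Real.sinh (l₁ * w.re) * Real.cos (b w.im),
        -Real.sinh (l₁ * w.re) * Real.sin (b w.im), 1]) := by
  rw [partialD, S.fderiv_helicoid_eq_ofFrame h₁ h₂]
  simp

/-- The induced metric is `(h cosh(l₁ u))² |dw|²`. -/
theorem metric_fderiv_helicoid (h₁ : l₁ ≠ 0) (h₂ : l₂ ≠ 0)
    (S : HelicoidSystem l₁ l₂ b x₃ h) (w a c : ℂ) :
    metric l₁ l₂ (helicoid l₁ l₂ b x₃ w) (fderiv ℝ (helicoid l₁ l₂ b x₃) w a)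
      (fderiv ℝ (helicoid l₁ l₂ b x₃) w c) =
      (h w.im * Real.cosh (l₁ * w.re)) ^ 2 * inner ℝ a c := by
  rw [S.fderiv_helicoid_eq_ofFrame h₁ h₂, S.fderiv_helicoid_eq_ofFrame h₁ h₂,
    metric_ofFrame_ofFrame h₁ h₂, Complex.inner]
  simp only [Pi.smul_apply, smul_eq_mul, Matrix.cons_val, Complex.mul_re, Complex.conj_re,
    Complex.conj_im]
  have e₁ := Real.sin_sq_add_cos_sq (b w.im)
  have e₂ := Real.cosh_sq (l₁ * w.re)
  linear_combination (h w.im ^ 2 * (Real.cosh (l₁ * w.re) ^ 2 * a.re * c.re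
    + Real.sinh (l₁ * w.re) ^ 2 * a.im * c.im)) * e₁ - h w.im ^ 2 * a.im * c.im * e₂

theorem isConformal_helicoid (h₁ : l₁ ≠ 0) (h₂ : l₂ ≠ 0) (S : HelicoidSystem l₁ l₂ b x₃ h) :
    IsConformal l₁ l₂ (helicoid l₁ l₂ b x₃) := by
  refine ⟨fun w => (h w.im * Real.cosh (l₁ * w.re)) ^ 2, fun w => ?_,
    S.metric_fderiv_helicoid h₁ h₂⟩
  have := mul_ne_zero (S.h_ne w.im) (Real.cosh_pos (l₁ * w.re)).ne'
  positivity

theorem isImmersion_helicoid (h₁ : l₁ ≠ 0) (h₂ : l₂ ≠ 0) (S : HelicoidSystem l₁ l₂ b x₃ h) :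
    IsImmersion (helicoid l₁ l₂ b x₃) := by
  refine ⟨S.contDiff_helicoid h₁ h₂, fun w => (injective_iff_map_eq_zero _).2 fun a ha => ?_⟩
  -- A vector killed by the differential has length zero in the induced metric.
  have hm := S.metric_fderiv_helicoid h₁ h₂ w a a
  have hne := mul_ne_zero (S.h_ne w.im) (Real.cosh_pos (l₁ * w.re)).ne'
  have h0 : metric l₁ l₂ (helicoid l₁ l₂ b x₃ w) 0 0 = 0 := by
    have hz : ∀ i, (0 : E2Tilde) i = 0 := fun _ => rfl
    simp [metric, hz]
  rw [ha, h0, eq_comm, mul_eq_zero, inner_self_eq_zero] at hm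
  exact hm.resolve_left (pow_ne_zero 2 hne)

/-! ### The normal and the Gauss map -/

theorem unitNormal_helicoid (h₁ : l₁ ≠ 0) (h₂ : l₂ ≠ 0) (S : HelicoidSystem l₁ l₂ b x₃ h)
    (w : ℂ) :
    unitNormal l₁ l₂ (helicoid l₁ l₂ b x₃) w = ofFrame l₁ l₂ (helicoid l₁ l₂ b x₃ w)
      ((Real.cosh (l₁ * w.re))⁻¹ •
        ![Real.cos (b w.im), Real.sin (b w.im), Real.sinh (l₁ * w.re)]) := by
  have hc := Real.cosh_pos (l₁ * w.re)
  have hh := S.h_ne w.im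
  have e₁ := Real.sin_sq_add_cos_sq (b w.im)
  have e₂ := Real.cosh_sq (l₁ * w.re)
  have hn : cross l₁ l₂ (helicoid l₁ l₂ b x₃ w) (partialD 1 (helicoid l₁ l₂ b x₃) w)
      (partialD Complex.I (helicoid l₁ l₂ b x₃) w) = ofFrame l₁ l₂ (helicoid l₁ l₂ b x₃ w)
      ((h w.im ^ 2 * Real.cosh (l₁ * w.re)) •
        ![Real.cos (b w.im), Real.sin (b w.im), Real.sinh (l₁ * w.re)]) := by
    rw [S.partialD_one_helicoid h₁ h₂, S.partialD_I_helicoid h₁ h₂, cross_ofFrame h₁ h₂]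
    congr 1
    simp only [cross_apply, smul_eq_mul, Matrix.cons_val, Matrix.smul_cons,
      Matrix.smul_empty]
    congr 1
    · ring
    congr 1
    · ring
    congr 1
    linear_combination h w.im ^ 2 * Real.cosh (l₁ * w.re) * Real.sinh (l₁ * w.re) * e₁
  have hm : √(metric l₁ l₂ (helicoid l₁ l₂ b x₃ w)
      (ofFrame l₁ l₂ (helicoid l₁ l₂ b x₃ w) ((h w.im ^ 2 * Real.cosh (l₁ * w.re)) •
        ![Real.cos (b w.im), Real.sin (b w.im), Real.sinh (l₁ * w.re)]))
      (ofFrame l₁ l₂ (helicoid l₁ l₂ b x₃ w) ((h w.im ^ 2 * Real.cosh (l₁ * w.re)) •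
        ![Real.cos (b w.im), Real.sin (b w.im), Real.sinh (l₁ * w.re)]))) =
      h w.im ^ 2 * Real.cosh (l₁ * w.re) ^ 2 := by
    rw [← Real.sqrt_sq (show 0 ≤ h w.im ^ 2 * Real.cosh (l₁ * w.re) ^ 2 by positivity)]
    congr 1
    rw [metric_ofFrame_ofFrame h₁ h₂]
    simp only [Pi.smul_apply, smul_eq_mul, Matrix.cons_val]
    linear_combination (h w.im ^ 4 * Real.cosh (l₁ * w.re) ^ 2) * (e₁ - e₂)
  simp only [unitNormal, hn, hm, smul_ofFrame, smul_smul]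
  congr 2
  field_simp

theorem gaussMap_helicoid (h₁ : l₁ ≠ 0) (h₂ : l₂ ≠ 0) (S : HelicoidSystem l₁ l₂ b x₃ h)
    (u v : ℝ) :
    gaussMap l₁ l₂ (helicoid l₁ l₂ b x₃) (u + v * Complex.I) =
      ((Complex.exp (-(l₁ * u : ℝ)) * Complex.exp (Complex.I * (b v : ℝ)) : ℂ) :
        OnePoint ℂ) := by
  have hc := Real.cosh_pos (l₁ * u)
  have hre : (u + v * Complex.I : ℂ).re = u := by simp
  have him : (u + v * Complex.I : ℂ).im = v := by simp
  have hsum : Real.cosh (l₁ * u) + Real.sinh (l₁ * u) = Real.exp (l₁ * u) :=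
    Real.cosh_add_sinh _
  have hne : ¬ (Real.cosh (l₁ * u))⁻¹ * Real.sinh (l₁ * u) = -1 := by
    intro H
    have : Real.cosh (l₁ * u) + Real.sinh (l₁ * u) = 0 := by
      field_simp at H
      linarith
    exact (Real.exp_pos _).ne' (hsum.symm.trans this)
  simp only [gaussMap, leftGaussMap, S.unitNormal_helicoid h₁ h₂, frameCoord_ofFrame h₁ h₂, hre,
    him, Pi.smul_apply, smul_eq_mul, Matrix.cons_val, if_neg hne]
  congr 1
  have hcC : (Real.cosh (l₁ * u) : ℂ) ≠ 0 := by exact_mod_cast hc.ne'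
  -- The denominator is `(cosh + sinh) / cosh = exp(l₁ u) / cosh(l₁ u)`.
  have hden : (1 + ((Real.cosh (l₁ * u))⁻¹ * Real.sinh (l₁ * u) : ℝ) : ℂ) =
      (Real.cosh (l₁ * u) : ℂ)⁻¹ * Complex.exp (l₁ * u : ℝ) := by
    rw [← Complex.ofReal_exp, ← hsum]
    push_cast at hcC ⊢
    field_simp
  rw [hden, Complex.exp_neg, mul_comm Complex.I (b v : ℂ), Complex.exp_mul_I, ← Complex.ofReal_cos,
    ← Complex.ofReal_sin]
  have hE := Complex.exp_ne_zero (l₁ * u : ℝ)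
  push_cast at hcC hE ⊢
  field_simp

/-! ### Second derivatives and the mean curvature -/

/-- Along the lines `v = const` the second derivative `X_uu` is tangent to the surface, so only the
Christoffel symbols contribute. -/
theorem secondForm_one_one_helicoid (h₁ : l₁ ≠ 0) (h₂ : l₂ ≠ 0)
    (S : HelicoidSystem l₁ l₂ b x₃ h) (w : ℂ) :
    secondForm l₁ l₂ (helicoid l₁ l₂ b x₃) 1 1 w =
      (l₁ ^ 2 - l₂ ^ 2) * h w.im ^ 2 * Real.cosh (l₁ * w.re) * Real.sinh (l₁ * w.re)
        * Real.sin (b w.im) * Real.cos (b w.im) := by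
  have hc := (Real.cosh_pos (l₁ * w.re)).ne'
  have hX : partialD 1 (helicoid l₁ l₂ b x₃) =
      sepMap (coordX l₁ l₂ b x₃ h) (coordY l₁ l₂ b x₃ h) (fun _ => 0)
        (fun u => -l₁ * Real.cosh (-l₁ * u)) := by
    funext z
    rw [partialD, S.fderiv_helicoid h₁ h₂]
    simp [sepMap]
  have hXX : partialD 1 (partialD 1 (helicoid l₁ l₂ b x₃)) w =
      E2Tilde.mk (coordX l₁ l₂ b x₃ h w.im * (l₁ ^ 2 * Real.sinh (-l₁ * w.re)))
        (coordY l₁ l₂ b x₃ h w.im * (l₁ ^ 2 * Real.sinh (-l₁ * w.re))) 0 := by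
    rw [hX, partialD, fderiv_sepMap (S.hasDerivAt_coordX h₁ h₂ _) (S.hasDerivAt_coordY h₁ h₂ _)
      (hasDerivAt_const _ _) (hasDerivAt_neg_mul_cosh_neg_mul _ _)]
    simp
  rw [secondForm, covDeriv, S.unitNormal_helicoid h₁ h₂, metric_add_left, hXX,
    S.partialD_one_helicoid h₁ h₂, metric_christoffel h₁ h₂, metric_ofFrame_right h₁ h₂,
    helicoid_two]
  simp only [Pi.smul_apply, smul_eq_mul, Matrix.cons_val, mk_zero, mk_one, mk_two, coordX, coordY,
    neg_mul, Real.sinh_neg]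
  field_simp
  ring

/-- The value on `X_v` is minus the value on `X_u`, so the trace of the second fundamental form
vanishes. -/
theorem secondForm_I_I_helicoid (h₁ : l₁ ≠ 0) (h₂ : l₂ ≠ 0)
    (S : HelicoidSystem l₁ l₂ b x₃ h) (w : ℂ) :
    secondForm l₁ l₂ (helicoid l₁ l₂ b x₃) Complex.I Complex.I w =
      -((l₁ ^ 2 - l₂ ^ 2) * h w.im ^ 2 * Real.cosh (l₁ * w.re) * Real.sinh (l₁ * w.re)
        * Real.sin (b w.im) * Real.cos (b w.im)) := by
  have hc := (Real.cosh_pos (l₁ * w.re)).ne'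
  have hX : partialD Complex.I (helicoid l₁ l₂ b x₃) =
      sepMap (coordX' l₁ l₂ b x₃ h) (coordY' l₁ l₂ b x₃ h) (fun v => l₁ * l₂ * h v)
        (fun u => Real.sinh (-l₁ * u)) := by
    funext z
    rw [partialD, S.fderiv_helicoid h₁ h₂]
    simp [sepMap]
  have hb := S.hasDerivAt_b w.im
  have hx := S.hasDerivAt_x₃ w.im
  have hh := S.hasDerivAt_h w.im
  have hXX : partialD Complex.I (partialD Complex.I (helicoid l₁ l₂ b x₃)) w = _ :=
    (congrArg (fun W => partialD Complex.I W w) hX).trans <| fderiv_sepMap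
      (hh.mul (((hx.cos.mul hb.cos).div_const l₁).sub ((hx.sin.mul hb.sin).div_const l₂)))
      (hh.mul (((hx.sin.mul hb.cos).div_const l₁).add ((hx.cos.mul hb.sin).div_const l₂)))
      (hh.const_mul (l₁ * l₂)) (hasDerivAt_sinh_neg_mul l₁ w.re) Complex.I
  rw [secondForm, covDeriv, S.unitNormal_helicoid h₁ h₂, metric_add_left, hXX,
    S.partialD_I_helicoid h₁ h₂, metric_christoffel h₁ h₂, metric_ofFrame_right h₁ h₂,
    helicoid_two]
  have e := Real.sin_sq_add_cos_sq (x₃ w.im)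
  have e₁ := Real.sin_sq_add_cos_sq (b w.im)
  have e₂ := Real.cosh_sq (l₁ * w.re)
  simp only [Pi.smul_apply, smul_eq_mul, Matrix.cons_val, mk_zero, mk_one, mk_two,
    neg_mul, Real.sinh_neg, Complex.I_re, Complex.I_im, Pi.add_apply, Pi.sub_apply, Pi.mul_apply]
  field_simp
  -- The rotation by the angle `x₃` drops out by `e`; what remains uses `cosh² = 1 + sinh²`.
  linear_combination (l₁ * l₂ * Real.sinh (l₁ * w.re) * (l₁ ^ 2 - l₂ ^ 2) * h w.im ^ 2
    * Real.sin (b w.im) * Real.cos (b w.im))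
    * ((Real.sin (b w.im) ^ 2 + Real.cos (b w.im) ^ 2 + 1) * e + e₁ + e₂)

theorem isMinimal_helicoid (h₁ : l₁ ≠ 0) (h₂ : l₂ ≠ 0) (S : HelicoidSystem l₁ l₂ b x₃ h) :
    IsMinimal l₁ l₂ (helicoid l₁ l₂ b x₃) := by
  intro w
  simp only [meanCurvature, firstForm, partialD, S.metric_fderiv_helicoid h₁ h₂,
    S.secondForm_one_one_helicoid h₁ h₂, S.secondForm_I_I_helicoid h₁ h₂, Complex.inner]
  simp

end

end HelicoidSystem

end E2Tilde

theorem theorem4p1 (l₁ l₂ K : ℝ) (hl₂ : 0 < l₂) (hl : l₂ ≤ l₁) (hK₀ : K ≠ 0) (hK : |K| < 1) :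
    (∃! b : ℝ → ℝ, E2Tilde.IsAngleFunction l₁ l₂ K b) ∧
    ∀ b : ℝ → ℝ, E2Tilde.IsAngleFunction l₁ l₂ K b →
      (∃! x₃ : ℝ → ℝ, E2Tilde.IsHeightFunction l₁ l₂ K b x₃) ∧
      ∀ x₃ : ℝ → ℝ, E2Tilde.IsHeightFunction l₁ l₂ K b x₃ →
        E2Tilde.IsImmersion (E2Tilde.helicoid l₁ l₂ b x₃) ∧
        E2Tilde.IsConformal l₁ l₂ (E2Tilde.helicoid l₁ l₂ b x₃) ∧
        E2Tilde.IsMinimal l₁ l₂ (E2Tilde.helicoid l₁ l₂ b x₃) ∧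
        ∀ u v : ℝ, E2Tilde.gaussMap l₁ l₂ (E2Tilde.helicoid l₁ l₂ b x₃) (u + v * Complex.I) =
          ((Complex.exp (-(l₁ * u : ℝ)) * Complex.exp (Complex.I * (b v : ℝ)) : ℂ) :
            OnePoint ℂ) := by
  have h₂ : l₂ ≠ 0 := hl₂.ne'
  have h₁ : l₁ ≠ 0 := (hl₂.trans_le hl).ne'
  refine ⟨E2Tilde.existsUnique_isAngleFunction hl₂ hl hK, fun b hb =>
    ⟨hb.existsUnique_isHeightFunction hl₂ hl hK, fun x₃ hx => ?_⟩⟩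
  have S := hb.helicoidSystem hl₂ hl hK₀ hK hx
  exact ⟨S.isImmersion_helicoid h₁ h₂, S.isConformal_helicoid h₁ h₂, S.isMinimal_helicoid h₁ h₂,
    S.gaussMap_helicoid h₁ h₂⟩
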